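/- Let $Q$ be a commutative Noetherian local ring, and let $\underline f=f_1,\dots,f_r$ and $\underline g=g_1,\dots,g_s$ be regular sequences in $Q$ such that $f_j=\sum_{i=1}^s a_{ji}g_i$ with $a_{ji}\in Q$ for $j=1,\dots,r$. Put $I=(\underline f)\subseteq(\underline g)$, $R=Q/I$ and $J=(\underline g)/I=(\underline g)R$. For $j_1<\dots<j_\ell$ and $i_1<\dots<i_\ell$ let $A^{i_1,\dots,i_\ell}_{j_1,\dots,j_\ell}=\det\big(a_{j_p i_q}\big)_{1\le p,q\le\ell}$. Let $K(\underline g;Q)$ be the Koszul complex, i.e. the exterior algebra on the free $Q$-module with basis $dg_1,\dots,dg_s$ with the antiderivation $\partial$ determined by $\partial(dg_i)=g_i$, and for $\ell\ge 0$ let $H_\ell(\underline g;R)=H_\ell(R\otimes_Q K(\underline g;Q))$, which is annihilated by $J$ and hence is an $R/J$-module. Then for every $\ell\ge0$ the elements $$\sum_{1\le i_1<\dots<i_\ell\le s}\overline{A^{i_1,\dots,i_\ell}_{j_1,\dots,j_\ell}}\;dg_{i_1}\cdots dg_{i_\ell}\qquad(1\le j_1<\dots<j_\ell\le r),$$ where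 $\overline{(\;\cdot\;)}$ denotes the image in $R$, are cycles of $R\otimes_Q K(\underline g;Q)$, and their homology classes, one for each $j_1<\dots<j_\ell$, form a basis of $H_\ell(\underline g;R)$ over $R/J$. -/

import Mathlib

open scoped TensorProduct

noncomputable section

namespace Koszul

/-- The generator `dg_i` of the Koszul complex: the `i`-th standard basis vector of `A^n`. -/
abbrev dg {A : Type*} [CommRing A] {n : ℕ} (i : Fin n) : Fin n → A := Pi.single i 1

/-- The linear functional on `A^n` that sends `dg_i` to `g_i`. -/
abbrev functional {A : Type*} [CommRing A] {n : ℕ} (g : Fin n → A) :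
    Module.Dual A (Fin n → A) :=
  Fintype.linearCombination A g

/-- Contraction with a functional lowers the exterior degree by one. -/
theorem contractLeft_mem {A : Type*} [CommRing A] {M : Type*} [AddCommGroup M] [Module A M]
    (φ : Module.Dual A M) (ℓ : ℕ) :
    ∀ x ∈ ⋀[A]^(ℓ + 1) M,
      CliffordAlgebra.contractLeft (Q := (0 : QuadraticForm A M)) φ x ∈ ⋀[A]^ℓ M := by
  induction ℓ with
  | zero =>
    intro x hx
    rw [ExteriorAlgebra.exteriorPower, zero_add, pow_one] at hx
    obtain ⟨m, rfl⟩ := hx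
    have h := CliffordAlgebra.contractLeft_ι (Q := (0 : QuadraticForm A M)) φ m
    rw [ExteriorAlgebra.exteriorPower, pow_zero]
    exact Submodule.mem_one.2 ⟨_, h.symm⟩
  | succ ℓ ih =>
    intro x hx
    rw [ExteriorAlgebra.exteriorPower, pow_succ'] at hx
    induction hx using Submodule.mul_induction_on' with
    | mem_mul_mem m hm y hy =>
      obtain ⟨m, rfl⟩ := hm
      have h := CliffordAlgebra.contractLeft_ι_mul (Q := (0 : QuadraticForm A M))
        (d := φ) m y
      refine (congrArg (· ∈ ⋀[A]^(ℓ + 1) M) h).mpr (Submodule.sub_mem _ ?_ ?_)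
      · exact Submodule.smul_mem _ _ hy
      · rw [ExteriorAlgebra.exteriorPower, pow_succ']
        exact Submodule.mul_mem_mul ⟨m, rfl⟩ (ih y hy)
    | add x _ y _ hx hy =>
      rw [map_add]
      exact Submodule.add_mem _ hx hy

/-- The differential `K_{ℓ+1}(g;A) → K_ℓ(g;A)` of the Koszul complex `K(g;A)`, where
`K_ℓ(g;A) = ⋀^ℓ(A^n)`: the restriction of the antiderivation `∂` of the exterior algebra with
`∂(dg_i) = g_i`, that is, `∂(m ∧ x) = ∂(m) x - m ∧ ∂(x)` for `m ∈ A^n`. -/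
def d {A : Type*} [CommRing A] {n : ℕ} (g : Fin n → A) (ℓ : ℕ) :
    ⋀[A]^(ℓ + 1) (Fin n → A) →ₗ[A] ⋀[A]^ℓ (Fin n → A) :=
  (CliffordAlgebra.contractLeft (Q := (0 : QuadraticForm A (Fin n → A)))
    (functional g)).restrict (contractLeft_mem (functional g) ℓ)

/-- The module `B ⊗_A K_ℓ(g;A)` in degree `ℓ` of the complex `B ⊗_A K(g;A)`. -/
def K (A : Type*) [CommRing A] (n : ℕ) (B : Type*) [CommRing B] [Algebra A B] (ℓ : ℕ) :=
  B ⊗[A] ⋀[A]^ℓ (Fin n → A)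

instance (A : Type*) [CommRing A] (n : ℕ) (B : Type*) [CommRing B] [Algebra A B] (ℓ : ℕ) :
    AddCommGroup (K A n B ℓ) :=
  inferInstanceAs (AddCommGroup (B ⊗[A] ⋀[A]^ℓ (Fin n → A)))

instance (A : Type*) [CommRing A] (n : ℕ) (B : Type*) [CommRing B] [Algebra A B] (ℓ : ℕ) :
    Module B (K A n B ℓ) :=
  inferInstanceAs (Module B (B ⊗[A] ⋀[A]^ℓ (Fin n → A)))

/-- The identity map between `B ⊗_A K_ℓ(g;A)` written as a tensor product and `K A n B ℓ`. -/
def ofTensor (A : Type*) [CommRing A] (n : ℕ) (B : Type*) [CommRing B] [Algebra A B] (ℓ : ℕ) :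
    (B ⊗[A] ⋀[A]^ℓ (Fin n → A)) ≃ₗ[B] K A n B ℓ :=
  LinearEquiv.refl B (B ⊗[A] ⋀[A]^ℓ (Fin n → A))

/-- The `B`-linear extension of an `A`-linear map between exterior powers of `A^n`. -/
def extend {A : Type*} [CommRing A] {n : ℕ} (B : Type*) [CommRing B] [Algebra A B] {k ℓ : ℕ}
    (φ : ⋀[A]^k (Fin n → A) →ₗ[A] ⋀[A]^ℓ (Fin n → A)) : K A n B k →ₗ[B] K A n B ℓ :=
  (ofTensor A n B ℓ).toLinearMap ∘ₗ φ.baseChange B ∘ₗ (ofTensor A n B k).symm.toLinearMap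

/-- The differential in degree `ℓ + 1` of the complex `B ⊗_A K(g;A)`. -/
abbrev dB {A : Type*} [CommRing A] {n : ℕ} (g : Fin n → A)
    (B : Type*) [CommRing B] [Algebra A B] (ℓ : ℕ) : K A n B (ℓ + 1) →ₗ[B] K A n B ℓ :=
  extend B (d g ℓ)

theorem extend_extend {A : Type*} [CommRing A] {n : ℕ} (B : Type*) [CommRing B] [Algebra A B]
    {k ℓ m : ℕ} (ψ : ⋀[A]^ℓ (Fin n → A) →ₗ[A] ⋀[A]^m (Fin n → A))
    (φ : ⋀[A]^k (Fin n → A) →ₗ[A] ⋀[A]^ℓ (Fin n → A)) (z : K A n B k) :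
    extend B ψ (extend B φ z) = extend B (ψ ∘ₗ φ) z := by
  simp [extend, LinearMap.baseChange_comp]

/-- The cycles in degree `ℓ` of the complex `B ⊗_A K(g;A)`; in degree `0` everything is a cycle. -/
def cycles {A : Type*} [CommRing A] {n : ℕ} (g : Fin n → A)
    (B : Type*) [CommRing B] [Algebra A B] : (ℓ : ℕ) → Submodule B (K A n B ℓ)
  | 0 => ⊤
  | ℓ + 1 => LinearMap.ker (dB g B ℓ)

/-- The boundaries in degree `ℓ` of the complex `B ⊗_A K(g;A)`. -/
def boundaries {A : Type*} [CommRing A] {n : ℕ} (g : Fin n → A)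
    (B : Type*) [CommRing B] [Algebra A B] (ℓ : ℕ) : Submodule B (K A n B ℓ) :=
  LinearMap.range (dB g B ℓ)

theorem d_comp_d {A : Type*} [CommRing A] {n : ℕ} (g : Fin n → A) (ℓ : ℕ) :
    d g ℓ ∘ₗ d g (ℓ + 1) = 0 := by
  ext1
  ext x
  exact congrArg _ (Subtype.ext (CliffordAlgebra.contractLeft_contractLeft _ _))

theorem boundaries_le_cycles {A : Type*} [CommRing A] {n : ℕ} (g : Fin n → A)
    (B : Type*) [CommRing B] [Algebra A B] (ℓ : ℕ) : boundaries g B ℓ ≤ cycles g B ℓ := by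
  cases ℓ with
  | zero => exact le_top
  | succ ℓ =>
    rintro _ ⟨y, rfl⟩
    refine (extend_extend B (d g ℓ) (d g (ℓ + 1)) y).trans ?_
    simp [extend, d_comp_d]

/-- The quotient `Z / (Y ∩ Z)` for submodules `Y`, `Z` of a module. -/
abbrev Subquotient {B M : Type*} [CommRing B] [AddCommGroup M] [Module B M]
    (Z Y : Submodule B M) :=
  Z ⧸ Y.submoduleOf Z

/-- The class of an element of `Z` in `Z / (Y ∩ Z)`. -/
abbrev Subquotient.mkQ {B M : Type*} [CommRing B] [AddCommGroup M] [Module B M]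
    (Z Y : Submodule B M) : Z →ₗ[B] Subquotient Z Y :=
  (Y.submoduleOf Z).mkQ

/-- The Koszul homology `H_ℓ(g;B) = H_ℓ(B ⊗_A K(g;A))`: cycles modulo boundaries. -/
def Homology {A : Type*} [CommRing A] {n : ℕ} (g : Fin n → A)
    (B : Type*) [CommRing B] [Algebra A B] (ℓ : ℕ) :=
  Subquotient (cycles g B ℓ) (boundaries g B ℓ)

instance {A : Type*} [CommRing A] {n : ℕ} (g : Fin n → A)
    (B : Type*) [CommRing B] [Algebra A B] (ℓ : ℕ) : AddCommGroup (Homology g B ℓ) :=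
  inferInstanceAs (AddCommGroup (Subquotient (cycles g B ℓ) (boundaries g B ℓ)))

instance {A : Type*} [CommRing A] {n : ℕ} (g : Fin n → A)
    (B : Type*) [CommRing B] [Algebra A B] (ℓ : ℕ) : Module B (Homology g B ℓ) :=
  inferInstanceAs (Module B (Subquotient (cycles g B ℓ) (boundaries g B ℓ)))

/-- The homology class of a cycle. -/
def homologyClass {A : Type*} [CommRing A] {n : ℕ} (g : Fin n → A)
    (B : Type*) [CommRing B] [Algebra A B] (ℓ : ℕ) : cycles g B ℓ →ₗ[B] Homology g B ℓ :=
  Subquotient.mkQ (cycles g B ℓ) (boundaries g B ℓ)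

/-- The class of a cycle vanishes exactly if the cycle is a boundary. -/
theorem homologyClass_eq_zero_iff {A : Type*} [CommRing A] {n : ℕ} (g : Fin n → A)
    (B : Type*) [CommRing B] [Algebra A B] (ℓ : ℕ) (z : cycles g B ℓ) :
    homologyClass g B ℓ z = 0 ↔ (z : K A n B ℓ) ∈ boundaries g B ℓ :=
  Submodule.Quotient.mk_eq_zero ((boundaries g B ℓ).submoduleOf (cycles g B ℓ))

/-- Left multiplication by `m ∈ M` on exterior powers. -/
def wedge {A : Type*} [CommRing A] {M : Type*} [AddCommGroup M] [Module A M]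
    (m : M) (ℓ : ℕ) : ⋀[A]^ℓ M →ₗ[A] ⋀[A]^(ℓ + 1) M :=
  (LinearMap.mulLeft A (ExteriorAlgebra.ι A m)).restrict fun x hx => by
    rw [ExteriorAlgebra.exteriorPower, pow_succ']
    exact Submodule.mul_mem_mul ⟨m, rfl⟩ hx

theorem d_wedge_zero {A : Type*} [CommRing A] {n : ℕ} (g : Fin n → A) (i : Fin n) :
    d g 0 ∘ₗ wedge (dg i) 0 = g i • LinearMap.id := by
  refine LinearMap.ext fun x => Subtype.ext ?_
  obtain ⟨x, hx⟩ := x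
  have hx' := hx
  rw [ExteriorAlgebra.exteriorPower, pow_zero] at hx'
  obtain ⟨a, rfl⟩ := Submodule.mem_one.1 hx'
  have h := CliffordAlgebra.contractLeft_ι_mul
    (Q := (0 : QuadraticForm A (Fin n → A))) (d := functional g) (dg i)
    (algebraMap A _ a)
  rw [CliffordAlgebra.contractLeft_algebraMap, mul_zero, sub_zero] at h
  refine h.trans ?_
  simp [functional, dg, Fintype.linearCombination_apply_single]

theorem d_wedge_succ {A : Type*} [CommRing A] {n : ℕ} (g : Fin n → A) (i : Fin n) (ℓ : ℕ) :
    d g (ℓ + 1) ∘ₗ wedge (dg i) (ℓ + 1) =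
      g i • LinearMap.id - wedge (dg i) ℓ ∘ₗ d g ℓ := by
  refine LinearMap.ext fun x => Subtype.ext ?_
  have h := CliffordAlgebra.contractLeft_ι_mul
    (Q := (0 : QuadraticForm A (Fin n → A))) (d := functional g) (dg i) x.1
  refine h.trans ?_
  have h' : functional g (dg i) = g i := by
    simp [functional, dg, Fintype.linearCombination_apply_single]
  rw [h']
  rfl

theorem smul_mem_boundaries {A : Type*} [CommRing A] {n : ℕ} (g : Fin n → A)
    (B : Type*) [CommRing B] [Algebra A B] (i : Fin n) (ℓ : ℕ)
    (z : K A n B ℓ) (hz : z ∈ cycles g B ℓ) :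
    algebraMap A B (g i) • z ∈ boundaries g B ℓ := by
  refine ⟨extend B (wedge (dg i) ℓ) z, (extend_extend B _ _ z).trans ?_⟩
  cases ℓ with
  | zero =>
    rw [d_wedge_zero]
    simp only [extend, LinearMap.baseChange_smul, LinearMap.baseChange_id, LinearMap.coe_comp,
      LinearEquiv.coe_coe, Function.comp_apply, LinearMap.smul_apply, LinearMap.id_coe, id_eq]
    rw [← algebraMap_smul B (g i), map_smul, LinearEquiv.apply_symm_apply]
  | succ ℓ =>
    have hz' : extend B (d g ℓ) z = 0 := hz
    have h : extend B (wedge (dg i) ℓ ∘ₗ d g ℓ) z = 0 := by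
      rw [← extend_extend, hz', map_zero]
    rw [d_wedge_succ]
    simp only [extend, LinearMap.baseChange_smul, LinearMap.baseChange_id,
      LinearMap.baseChange_sub, LinearMap.coe_comp, LinearEquiv.coe_coe, Function.comp_apply,
      LinearMap.smul_apply, LinearMap.sub_apply, LinearMap.id_coe, id_eq, map_sub] at h ⊢
    rw [h, sub_zero, ← algebraMap_smul B (g i), map_smul, LinearEquiv.apply_symm_apply]

/-- The ideal `(g)B` of `B` generated by the images of `g_1, …, g_n`. -/
abbrev extIdeal {A : Type*} [CommRing A] {n : ℕ} (g : Fin n → A)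
    (B : Type*) [CommRing B] [Algebra A B] : Ideal B :=
  (Ideal.span (Set.range g)).map (algebraMap A B)

/-- The ideal `(g)B` annihilates the Koszul homology `H_ℓ(g;B)`. -/
theorem isTorsionBySet_homology {A : Type*} [CommRing A] {n : ℕ} (g : Fin n → A)
    (B : Type*) [CommRing B] [Algebra A B] (ℓ : ℕ) :
    Module.IsTorsionBySet B (Homology g B ℓ) (extIdeal g B) := by
  rw [extIdeal, Ideal.map_span, ← Set.range_comp, Ideal.span,
    ← Module.isTorsionBySet_iff_is_torsion_by_span]
  rintro h ⟨_, i, rfl⟩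
  obtain ⟨z, rfl⟩ : ∃ z, homologyClass g B ℓ z = h :=
    Submodule.mkQ_surjective ((boundaries g B ℓ).submoduleOf (cycles g B ℓ)) h
  change algebraMap A B (g i) • homologyClass g B ℓ z = 0
  rw [← map_smul]
  exact (homologyClass_eq_zero_iff g B ℓ _).2 (smul_mem_boundaries g B i ℓ z.1 z.2)

/-- The `B/(g)B`-module structure of `H_ℓ(g;B)` induced by its `B`-module structure. -/
instance {A : Type*} [CommRing A] {n : ℕ} (g : Fin n → A)
    (B : Type*) [CommRing B] [Algebra A B] (ℓ : ℕ) :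
    Module (B ⧸ extIdeal g B) (Homology g B ℓ) :=
  (isTorsionBySet_homology g B ℓ).module

/-- The element `∑_{i_1<⋯<i_ℓ} (image in B of a^{i_1…i_ℓ}_{j_1…j_ℓ}) dg_{i_1}⋯dg_{i_ℓ}` of
`B ⊗_A K_ℓ(g;A)`, where `a^{i_1…i_ℓ}_{j_1…j_ℓ}` is the minor of `a` on rows `j` and columns `i`. -/
def minorElement {A : Type*} [CommRing A] {r n : ℕ} (a : Matrix (Fin r) (Fin n) A)
    (B : Type*) [CommRing B] [Algebra A B] (ℓ : ℕ) (j : Fin ℓ ↪o Fin r) : K A n B ℓ :=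
  ∑ i : Fin ℓ ↪o Fin n, ofTensor A n B ℓ
    (algebraMap A B (a.submatrix j i).det ⊗ₜ[A] exteriorPower.ιMulti A ℓ (fun k => dg (i k)))

end Koszul

end

/-! The matrix `a` defines a linear map `L` from `A^r` to `A^s` that carries the functional of `f`
to that of `g`, so `ExteriorAlgebra.map L` is a chain map from the Koszul complex of `f` to that of
`g`. Modulo `(f)` the source has zero differential, and in the standard bases the entries of the map
are the minors of `a`. It remains to see that the induced map from the exterior algebra over `R/J`
to the homology is bijective.

This is proved by adjoining the `f_k` one at a time. As `f_k` is regular modulo its predecessors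
`I_k`, multiplication by it gives a short exact sequence of complexes `K(g)/I_k → K(g)/I_k →
K(g)/I_{k+1}`; on homology it is zero, and the quotient's homology acquires one more exterior
generator, `L(df_k)`. The argument is written with lifts over `A`: a cycle modulo `I_k` is an
element whose differential lies in `I_k • ⊤`. Surjectivity is `exists_eq_map_add_contract`,
injectivity is `mem_smul_top_of_map_eq`. Surjectivity starts from the acyclicity of `K(g)`
(`exists_eq_add_contract`), injectivity from the fact that boundaries have coefficients in `(g)`.

All this takes place in the whole exterior algebra; degrees are separated afterwards by `proj`. -/

namespace Koszul

/-! ### Contractions and maps of exterior algebras -/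

section Contraction

variable {A : Type*} [CommRing A] {M N : Type*} [AddCommGroup M] [Module A M]
  [AddCommGroup N] [Module A N]

/-- Contraction of the exterior algebra with a linear functional. -/
noncomputable def contract (φ : Module.Dual A M) : ExteriorAlgebra A M →ₗ[A] ExteriorAlgebra A M :=
  CliffordAlgebra.contractLeft (Q := (0 : QuadraticForm A M)) φ

theorem contract_algebraMap (φ : Module.Dual A M) (c : A) :
    contract φ (algebraMap A _ c) = 0 :=
  CliffordAlgebra.contractLeft_algebraMap (Q := (0 : QuadraticForm A M)) φ c

theorem contract_ι_mul (φ : Module.Dual A M) (m : M) (x : ExteriorAlgebra A M) :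
    contract φ (ExteriorAlgebra.ι A m * x) =
      φ m • x - ExteriorAlgebra.ι A m * contract φ x :=
  CliffordAlgebra.contractLeft_ι_mul (Q := (0 : QuadraticForm A M)) φ m x

theorem contract_ι (φ : Module.Dual A M) (m : M) :
    contract φ (ExteriorAlgebra.ι A m) = algebraMap A _ (φ m) :=
  CliffordAlgebra.contractLeft_ι (Q := (0 : QuadraticForm A M)) φ m

theorem contract_contract (φ : Module.Dual A M) (x : ExteriorAlgebra A M) :
    contract φ (contract φ x) = 0 :=
  CliffordAlgebra.contractLeft_contractLeft (Q := (0 : QuadraticForm A M)) φ x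

theorem contract_comm (φ ψ : Module.Dual A M) (x : ExteriorAlgebra A M) :
    contract φ (contract ψ x) = -contract ψ (contract φ x) :=
  CliffordAlgebra.contractLeft_comm (Q := (0 : QuadraticForm A M)) φ ψ x

theorem exteriorAlgebra_left_induction {P : ExteriorAlgebra A M → Prop}
    (algebraMap : ∀ c, P (algebraMap A _ c)) (add : ∀ x y, P x → P y → P (x + y))
    (ι_mul : ∀ x m, P x → P (ExteriorAlgebra.ι A m * x)) (x : ExteriorAlgebra A M) : P x :=
  CliffordAlgebra.left_induction (0 : QuadraticForm A M) (P := P) algebraMap add ι_mul x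

theorem contract_map (L : M →ₗ[A] N) (φ : Module.Dual A N) (x : ExteriorAlgebra A M) :
    contract φ (ExteriorAlgebra.map L x) = ExteriorAlgebra.map L (contract (φ ∘ₗ L) x) := by
  induction x using exteriorAlgebra_left_induction with
  | algebraMap c => simp [contract_algebraMap]
  | add x y hx hy => simp [hx, hy]
  | ι_mul x m hx => simp [contract_ι_mul, hx]

theorem ι_mul_self_mul (m : M) (x : ExteriorAlgebra A M) :
    ExteriorAlgebra.ι A m * (ExteriorAlgebra.ι A m * x) = 0 := by
  rw [← mul_assoc, ExteriorAlgebra.ι_sq_zero, zero_mul]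

theorem ι_mul_ι_mul (m m' : M) (x : ExteriorAlgebra A M) :
    ExteriorAlgebra.ι A m * (ExteriorAlgebra.ι A m' * x) =
      -(ExteriorAlgebra.ι A m' * (ExteriorAlgebra.ι A m * x)) := by
  rw [← mul_assoc, ← mul_assoc, eq_neg_iff_add_eq_zero, ← add_mul,
    ExteriorAlgebra.ι_add_mul_swap, zero_mul]

/-- Terms of order two and higher in the correction would contain `m` twice and so vanish. With a
coordinate form and its basis vector this says that an element killed by the contraction is fixed by
the map deleting that coordinate. -/
theorem map_id_sub_smulRight (φ : Module.Dual A M) (m : M) (x : ExteriorAlgebra A M) :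
    ExteriorAlgebra.map (LinearMap.id - φ.smulRight m) x =
      x - ExteriorAlgebra.ι A m * contract φ x := by
  induction x using exteriorAlgebra_left_induction with
  | algebraMap c => simp [contract_algebraMap]
  | add x y hx hy => rw [map_add, hx, hy, map_add, mul_add]; abel
  | ι_mul x m' hx =>
    rw [map_mul, hx, contract_ι_mul, ExteriorAlgebra.map_apply_ι]
    simp only [LinearMap.sub_apply, LinearMap.id_apply, LinearMap.smulRight_apply, map_sub,
      map_smul, sub_mul, mul_sub, smul_mul_assoc, mul_smul_comm, ι_mul_self_mul]
    rw [ι_mul_ι_mul m m', smul_zero]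
    abel

end Contraction

/-! ### Elements with coefficients in an ideal -/

section IdealSMul

variable {A : Type*} [CommRing A] {M N : Type*} [AddCommGroup M] [Module A M]
  [AddCommGroup N] [Module A N]

theorem map_mem_smul_top {I : Ideal A} (φ : M →ₗ[A] N) {x : M}
    (hx : x ∈ I • (⊤ : Submodule A M)) : φ x ∈ I • (⊤ : Submodule A N) := by
  have h := Submodule.mem_map_of_mem (f := φ) hx
  rw [Submodule.map_smul''] at h
  exact Submodule.smul_mono le_rfl le_top h

theorem map_mem_of_mem_smul_top {I : Ideal A} (φ : M →ₗ[A] A) {x : M}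
    (hx : x ∈ I • (⊤ : Submodule A M)) : φ x ∈ I := by
  simpa using map_mem_smul_top φ hx

theorem mem_smul_top_iff_repr {ι : Type*} (b : Module.Basis ι A M) (I : Ideal A) (x : M) :
    x ∈ I • (⊤ : Submodule A M) ↔ ∀ i, b.repr x i ∈ I := by
  refine ⟨fun hx i => map_mem_of_mem_smul_top (b.coord i) hx, fun h => ?_⟩
  rw [← b.linearCombination_repr x, Finsupp.linearCombination_apply]
  exact Submodule.sum_mem _ fun i _ => Submodule.smul_mem_smul (h i) trivial

/-- Coordinates in a basis carry regularity modulo `I` from the ring to a free module; this is how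
the regularity of `f` acts on the Koszul complex. -/
theorem mem_smul_top_of_smul_mem [Module.Free A M] {I : Ideal A} {c : A}
    (hc : ∀ a, c * a ∈ I → a ∈ I) {x : M} (hx : c • x ∈ I • (⊤ : Submodule A M)) :
    x ∈ I • (⊤ : Submodule A M) := by
  have b := Module.Free.chooseBasis A M
  rw [mem_smul_top_iff_repr b] at hx ⊢
  exact fun i => hc _ (by simpa using hx i)

theorem mul_mem_smul_top {B : Type*} [Ring B] [Algebra A B] {I : Ideal A} (u : B) {x : B}
    (hx : x ∈ I • (⊤ : Submodule A B)) : u * x ∈ I • (⊤ : Submodule A B) :=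
  map_mem_smul_top (LinearMap.mulLeft A u) hx

instance {n : ℕ} : Module.Free A (ExteriorAlgebra A (Fin n → A)) :=
  .of_basis (Pi.basisFun A (Fin n)).ExteriorAlgebra

end IdealSMul

/-! ### The exterior algebra on the first `k` generators -/

section Truncation

variable {A : Type*} [CommRing A] {n : ℕ}

/-- The exterior algebra on the first `k` generators, as the submodule of the exterior algebra
of `A^n` annihilated by the contractions with the remaining coordinates. -/
noncomputable def truncation (A : Type*) [CommRing A] (n k : ℕ) :
    Submodule A (ExteriorAlgebra A (Fin n → A)) :=
  ⨅ i : Fin n, ⨅ _ : k ≤ i, LinearMap.ker (contract (LinearMap.proj i))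

theorem mem_truncation {k : ℕ} {x : ExteriorAlgebra A (Fin n → A)} :
    x ∈ truncation A n k ↔ ∀ i : Fin n, k ≤ i → contract (LinearMap.proj i) x = 0 := by
  simp [truncation]

theorem truncation_mono {k l : ℕ} (h : k ≤ l) : truncation A n k ≤ truncation A n l :=
  fun _ hx => mem_truncation.2 fun i hi => mem_truncation.1 hx i (h.trans hi)

theorem mem_truncation_self (x : ExteriorAlgebra A (Fin n → A)) : x ∈ truncation A n n :=
  mem_truncation.2 fun i hi => absurd i.2 (by omega)

theorem algebraMap_mem_truncation (k : ℕ) (c : A) :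
    algebraMap A (ExteriorAlgebra A (Fin n → A)) c ∈ truncation A n k :=
  mem_truncation.2 fun _ _ => contract_algebraMap _ _

theorem contract_mem_truncation {k : ℕ} (φ : Module.Dual A (Fin n → A))
    {x : ExteriorAlgebra A (Fin n → A)} (hx : x ∈ truncation A n k) :
    contract φ x ∈ truncation A n k :=
  mem_truncation.2 fun i hi => by
    rw [contract_comm, mem_truncation.1 hx i hi, map_zero, neg_zero]

theorem ι_dg_mul_mem_truncation {k : ℕ} {i : Fin n} (hi : i < k)
    {x : ExteriorAlgebra A (Fin n → A)} (hx : x ∈ truncation A n k) :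
    ExteriorAlgebra.ι A (dg i) * x ∈ truncation A n k :=
  mem_truncation.2 fun j hj => by
    have hij : j ≠ i := by rintro rfl; omega
    rw [contract_ι_mul, mem_truncation.1 hx j hj]
    simp [hij]

/-- The decomposition of the exterior algebra on `k + 1` generators with respect to the last. -/
theorem exists_eq_add_ι_mul (k : Fin n) {z : ExteriorAlgebra A (Fin n → A)}
    (hz : z ∈ truncation A n (k + 1)) :
    ∃ x ∈ truncation A n k, ∃ y ∈ truncation A n k,
      z = x + ExteriorAlgebra.ι A (dg k) * y := by
  -- Contraction with the `k`-th coordinate reads off the factor of `dg k`.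
  have hy : contract (LinearMap.proj k) z ∈ truncation A n k := mem_truncation.2 fun i hi => by
    rcases hi.eq_or_lt with h | h
    · rw [← Fin.ext h, contract_contract]
    · rw [contract_comm, mem_truncation.1 hz i h, map_zero, neg_zero]
  refine ⟨z - ExteriorAlgebra.ι A (dg k) * contract (LinearMap.proj k) z,
    mem_truncation.2 fun i hi => ?_, _, hy, by simp⟩
  rw [map_sub, contract_ι_mul, mem_truncation.1 hy i hi]
  rcases hi.eq_or_lt with h | h
  · simp [← Fin.ext h]
  · have hik : i ≠ k := by rintro rfl; omega
    simp [hik, mem_truncation.1 hz i h]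

theorem eq_zero_of_add_ι_mul_eq_zero (k : Fin n) {x y : ExteriorAlgebra A (Fin n → A)}
    (hx : x ∈ truncation A n k) (hy : y ∈ truncation A n k)
    (h : x + ExteriorAlgebra.ι A (dg k) * y = 0) : x = 0 ∧ y = 0 := by
  have hy0 : y = 0 := by
    have := congrArg (contract (LinearMap.proj k)) h
    rw [map_add, contract_ι_mul, mem_truncation.1 hx k le_rfl, mem_truncation.1 hy k le_rfl] at this
    simpa using this
  subst hy0
  simpa using h

/-- Deleting one coordinate after another fixes `x`, by `map_id_sub_smulRight`. After all deletions
the linear map is zero, and the algebra map it induces is the projection to scalars. -/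
theorem exists_algebraMap_eq_of_mem_truncation_zero {x : ExteriorAlgebra A (Fin n → A)}
    (hx : x ∈ truncation A n 0) : ∃ c, algebraMap A _ c = x := by
  have key : ∀ t : Finset (Fin n), ExteriorAlgebra.map
      (LinearMap.id - ∑ i ∈ t, (LinearMap.proj i).smulRight (dg i) :
        (Fin n → A) →ₗ[A] Fin n → A) x = x := by
    intro t
    induction t using Finset.induction_on with
    | empty => simp
    | insert i t hi ih =>
      have hL : (LinearMap.id - ∑ j ∈ insert i t, (LinearMap.proj j : Module.Dual A (Fin n → A)).smulRight (dg j) :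
          (Fin n → A) →ₗ[A] Fin n → A) =
          (LinearMap.id - (LinearMap.proj i : Module.Dual A (Fin n → A)).smulRight (dg i)) ∘ₗ
            (LinearMap.id - ∑ j ∈ t, (LinearMap.proj j : Module.Dual A (Fin n → A)).smulRight (dg j)) := by
        have h0 : ((LinearMap.proj i : Module.Dual A (Fin n → A)).smulRight (dg i) : (Fin n → A) →ₗ[A] Fin n → A) ∘ₗ
            ∑ j ∈ t, (LinearMap.proj j : Module.Dual A (Fin n → A)).smulRight (dg j) = 0 := by
          refine LinearMap.ext fun v => ?_
          simp only [LinearMap.comp_apply, LinearMap.sum_apply, map_sum, LinearMap.zero_apply]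
          refine Finset.sum_eq_zero fun j hj => ?_
          have hij : i ≠ j := by rintro rfl; exact hi hj
          simp [hij]
        simp only [LinearMap.sub_comp, LinearMap.comp_sub, h0, Finset.sum_insert hi,
          LinearMap.id_comp, LinearMap.comp_id]
        abel
      rw [hL, ← ExteriorAlgebra.map_comp_map, AlgHom.comp_apply, ih, map_id_sub_smulRight,
        mem_truncation.1 hx i (Nat.zero_le _), mul_zero, sub_zero]
  have h := key Finset.univ
  have h0 : (LinearMap.id - ∑ i, (LinearMap.proj i : Module.Dual A (Fin n → A)).smulRight (dg i) :
      (Fin n → A) →ₗ[A] Fin n → A) = 0 := by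
    refine LinearMap.ext fun v => ?_
    ext j
    simp [Finset.sum_apply, Pi.single_apply]
  rw [h0] at h
  refine ⟨ExteriorAlgebra.algebraMapInv x, Eq.trans ?_ h⟩
  have hmap : (Algebra.ofId A (ExteriorAlgebra A (Fin n → A))).comp
      ExteriorAlgebra.algebraMapInv =
      ExteriorAlgebra.map (0 : (Fin n → A) →ₗ[A] Fin n → A) := by
    apply ExteriorAlgebra.hom_ext
    refine LinearMap.ext fun v => ?_
    simp [ExteriorAlgebra.algebraMapInv]
  exact DFunLike.congr_fun hmap x

end Truncation

/-! ### Acyclicity of the Koszul complex of a weakly regular sequence -/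

section Acyclic

variable {A : Type*} [CommRing A] {n : ℕ}

/-- The ideal generated by the first `k` elements of a sequence. -/
def initialIdeal (g : Fin n → A) (k : ℕ) : Ideal A := Ideal.span (g '' {i | (i : ℕ) < k})

theorem mem_initialIdeal (g : Fin n → A) {k : ℕ} {i : Fin n} (hi : i < k) :
    g i ∈ initialIdeal g k := Ideal.subset_span ⟨i, hi, rfl⟩

theorem initialIdeal_mono (g : Fin n → A) {k l : ℕ} (h : k ≤ l) :
    initialIdeal g k ≤ initialIdeal g l :=
  Ideal.span_mono (Set.image_mono fun _ hi => lt_of_lt_of_le hi h)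

theorem initialIdeal_zero (g : Fin n → A) : initialIdeal g 0 = ⊥ := by
  simp [initialIdeal]

theorem initialIdeal_self (g : Fin n → A) : initialIdeal g n = Ideal.span (Set.range g) := by
  simp [initialIdeal]

theorem initialIdeal_succ (g : Fin n → A) (k : Fin n) :
    initialIdeal g (k + 1) = Ideal.span {g k} ⊔ initialIdeal g k := by
  rw [initialIdeal, initialIdeal, ← Ideal.span_union, ← Set.image_singleton, ← Set.image_union]
  congr 2
  ext i
  simp only [Set.mem_ofPred_eq, Set.mem_union, Set.mem_singleton_iff, Fin.ext_iff]
  omega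

theorem mem_initialIdeal_succ_smul_top {M : Type*} [AddCommGroup M] [Module A M]
    (g : Fin n → A) (k : Fin n) {x : M}
    (hx : x ∈ initialIdeal g (k + 1) • (⊤ : Submodule A M)) :
    ∃ u, ∃ v ∈ initialIdeal g k • (⊤ : Submodule A M), x = g k • u + v := by
  rw [initialIdeal_succ, Submodule.sup_smul] at hx
  obtain ⟨w, hw, v, hv, rfl⟩ := Submodule.mem_sup.1 hx
  rw [Submodule.ideal_span_singleton_smul] at hw
  obtain ⟨u, -, rfl⟩ := (Submodule.mem_smul_pointwise_iff_exists _ _ _).1 hw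
  exact ⟨u, v, hv, rfl⟩

theorem smul_add_mem_initialIdeal_succ {M : Type*} [AddCommGroup M] [Module A M]
    (g : Fin n → A) (k : Fin n) (u : M) {v : M}
    (hv : v ∈ initialIdeal g k • (⊤ : Submodule A M)) :
    g k • u + v ∈ initialIdeal g (k + 1) • (⊤ : Submodule A M) :=
  add_mem (Submodule.smul_mem_smul (mem_initialIdeal g (Nat.lt_succ_self _)) trivial)
    (Submodule.smul_mono_left (initialIdeal_mono g (Nat.le_succ _)) hv)

/-- Every element of the sequence is a nonzerodivisor modulo the preceding ones. -/
def WeaklyRegular (g : Fin n → A) : Prop :=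
  ∀ (k : Fin n) (c : A), g k * c ∈ initialIdeal g k → c ∈ initialIdeal g k

theorem weaklyRegular_of_isWeaklyRegular (g : Fin n → A)
    (hg : RingTheory.Sequence.IsWeaklyRegular A (List.ofFn g)) : WeaklyRegular g := by
  intro k c hc
  have h := (RingTheory.Sequence.isWeaklyRegular_iff A _).1 hg k (by simp)
  have hI : (Ideal.ofList ((List.ofFn g).take k) • ⊤ : Submodule A A) = initialIdeal g k := by
    rw [smul_eq_mul, Ideal.mul_top, Ideal.ofList, initialIdeal]
    congr 1
    ext x
    simp only [List.mem_take_iff_getElem, Set.mem_ofPred_eq, List.length_ofFn, List.getElem_ofFn,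
      Set.mem_image]
    constructor
    · rintro ⟨i, hi, rfl⟩
      exact ⟨⟨i, by omega⟩, by simp; omega, rfl⟩
    · rintro ⟨i, hi, rfl⟩
      exact ⟨i, by omega, rfl⟩
  rw [hI] at h
  rw [isSMulRegular_iff_right_eq_zero_of_smul] at h
  have := h (Submodule.Quotient.mk c) (by
    rw [← Submodule.Quotient.mk_smul, Submodule.Quotient.mk_eq_zero]
    simpa using hc)
  rwa [Submodule.Quotient.mk_eq_zero] at this

theorem functional_dg (g : Fin n → A) (i : Fin n) : functional g (dg i) = g i := by
  simp [functional, dg, Fintype.linearCombination_apply_single]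

theorem contract_mem_initialIdeal (g : Fin n → A) {k : ℕ} (hk : k ≤ n) :
    ∀ z ∈ truncation A n k, contract (functional g) z ∈
      initialIdeal g k • (⊤ : Submodule A (ExteriorAlgebra A (Fin n → A))) := by
  induction k with
  | zero =>
    intro z hz
    obtain ⟨c, rfl⟩ := exists_algebraMap_eq_of_mem_truncation_zero hz
    rw [contract_algebraMap]
    exact zero_mem _
  | succ k ih =>
    intro z hz
    obtain ⟨x, hx, y, hy, rfl⟩ := exists_eq_add_ι_mul ⟨k, hk⟩ hz
    have hx' := ih (by omega) x hx
    have hy' := mul_mem_smul_top (ExteriorAlgebra.ι A (dg ⟨k, hk⟩)) (ih (by omega) y hy)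
    rw [map_add, contract_ι_mul, functional_dg]
    have h : ∀ p q r : ExteriorAlgebra A (Fin n → A), p + (q - r) = q + (p - r) := by
      intros; abel
    rw [h]
    exact smul_add_mem_initialIdeal_succ g ⟨k, hk⟩ y (sub_mem hx' hy')

theorem exists_contract_eq_algebraMap (g : Fin n → A) {k : ℕ} {c : A}
    (hc : c ∈ initialIdeal g k) :
    ∃ y ∈ truncation A n k, contract (functional g) y = algebraMap A _ c := by
  induction hc using Submodule.span_induction with
  | mem c hc =>
    obtain ⟨i, hi, rfl⟩ := hc
    refine ⟨ExteriorAlgebra.ι A (dg i), ?_, by rw [contract_ι, functional_dg]⟩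
    simpa using ι_dg_mul_mem_truncation hi (algebraMap_mem_truncation k (1 : A))
  | zero => exact ⟨0, zero_mem _, by simp⟩
  | add a b _ _ ha hb =>
    obtain ⟨x, hx, hx'⟩ := ha
    obtain ⟨y, hy, hy'⟩ := hb
    exact ⟨x + y, add_mem hx hy, by rw [map_add, hx', hy', map_add]⟩
  | smul a b _ hb =>
    obtain ⟨y, hy, hy'⟩ := hb
    exact ⟨a • y, Submodule.smul_mem _ _ hy, by
      rw [map_smul, hy', smul_eq_mul, map_mul, Algebra.smul_def]⟩

theorem mem_of_algebraMap_mem_smul_top {I : Ideal A} {c : A}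
    (h : algebraMap A (ExteriorAlgebra A (Fin n → A)) c ∈
      I • (⊤ : Submodule A (ExteriorAlgebra A (Fin n → A)))) : c ∈ I := by
  simpa using map_mem_of_mem_smul_top
    (ExteriorAlgebra.algebraMapInv (R := A) (M := Fin n → A)).toLinearMap h

/-- The Koszul complex of a weakly regular sequence is acyclic in positive degrees. -/
theorem exists_eq_add_contract_of_truncation (g : Fin n → A) (hg : WeaklyRegular g) {k : ℕ}
    (hk : k ≤ n) : ∀ z ∈ truncation A n k, contract (functional g) z = 0 →
      ∃ c, ∃ y ∈ truncation A n k, z = algebraMap A _ c + contract (functional g) y := by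
  induction k with
  | zero =>
    intro z hz _
    obtain ⟨c, rfl⟩ := exists_algebraMap_eq_of_mem_truncation_zero hz
    exact ⟨c, 0, zero_mem _, by simp⟩
  | succ k ih =>
    intro z hz hdz
    obtain ⟨x, hx, y, hy, rfl⟩ := exists_eq_add_ι_mul ⟨k, hk⟩ hz
    set e := ExteriorAlgebra.ι A (dg (A := A) (⟨k, hk⟩ : Fin n)) with he
    set D := contract (functional g) with hD
    rw [map_add, contract_ι_mul, functional_dg] at hdz
    -- The parts of the differential of `x + e * y` without and with `e` vanish separately: `D x +
    -- g_k y = 0` and `D y = 0`.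
    have hsplit := eq_zero_of_add_ι_mul_eq_zero ⟨k, hk⟩
      (x := D x + g ⟨k, hk⟩ • y) (y := -D y)
      (add_mem (contract_mem_truncation _ hx) (Submodule.smul_mem _ _ hy))
      (neg_mem (contract_mem_truncation _ hy)) (by
        rw [← hdz, mul_neg]; abel)
    obtain ⟨h1, h2⟩ := hsplit
    obtain ⟨c, w, hw, rfl⟩ := ih (by omega) y hy (neg_eq_zero.1 h2)
    have hgc : algebraMap A _ (g ⟨k, hk⟩ * c) = -D (x + g ⟨k, hk⟩ • w) := by
      rw [map_add, map_smul, map_mul, ← Algebra.smul_def, eq_neg_iff_add_eq_zero, ← h1, smul_add]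
      abel
    -- The scalar `c` is the obstruction to `y` being a boundary. Regularity of `g_k` puts it in the
    -- preceding ideal, whose elements are boundaries.
    have hc : c ∈ initialIdeal g k := hg ⟨k, hk⟩ c <| mem_of_algebraMap_mem_smul_top (n := n) <| by
      rw [hgc]
      exact neg_mem (contract_mem_initialIdeal g (by omega) _
        (add_mem hx (Submodule.smul_mem _ _ hw)))
    obtain ⟨m, hm, hmc⟩ := exists_contract_eq_algebraMap g hc
    rw [← hmc, ← hD, ← map_add] at h1 ⊢
    set y' := m + w with hy'
    have hy'm : y' ∈ truncation A n k := add_mem hm hw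
    -- Now `y = D y'`, and adding `D (e * y')` to the original cycle removes its `e`-part, leaving
    -- `x + g_k y'`.
    obtain ⟨c', v, hv, hvc⟩ := ih (by omega) (x + g ⟨k, hk⟩ • y')
      (add_mem hx (Submodule.smul_mem _ _ hy'm)) (by rw [map_add, map_smul, h1])
    have hle := truncation_mono (A := A) (n := n) (Nat.le_succ k)
    refine ⟨c', v - e * y', sub_mem (hle hv)
      (ι_dg_mul_mem_truncation (Nat.lt_succ_self k) (hle hy'm)), ?_⟩
    rw [map_sub, contract_ι_mul, functional_dg, ← hD, ← he, eq_sub_of_add_eq hvc]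
    abel

theorem exists_eq_add_contract (g : Fin n → A) (hg : WeaklyRegular g)
    {z : ExteriorAlgebra A (Fin n → A)} (hz : contract (functional g) z = 0) :
    ∃ c y, z = algebraMap A _ c + contract (functional g) y := by
  obtain ⟨c, y, -, h⟩ :=
    exists_eq_add_contract_of_truncation g hg le_rfl z (mem_truncation_self z) hz
  exact ⟨c, y, h⟩

end Acyclic

/-! ### Comparison of the Koszul complexes of `f` and `g` -/

section Comparison

variable {A : Type*} [CommRing A] {r s : ℕ} (f : Fin r → A) (g : Fin s → A)
  (L : (Fin r → A) →ₗ[A] Fin s → A)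

/-- The map induced by `L` commutes with the differentials, and on the first `k` generators the
differential of `K(f)` has coefficients among the first `k` elements of `f`. -/
theorem contract_map_mem (hL : functional g ∘ₗ L = functional f) {k : ℕ} (hk : k ≤ r)
    {c : ExteriorAlgebra A (Fin r → A)} (hc : c ∈ truncation A r k) :
    contract (functional g) (ExteriorAlgebra.map L c) ∈
      initialIdeal f k • (⊤ : Submodule A (ExteriorAlgebra A (Fin s → A))) := by
  rw [contract_map, hL]
  exact map_mem_smul_top (ExteriorAlgebra.map L).toLinearMap (contract_mem_initialIdeal f hk c hc)

/-- Modulo the first `k` elements of `f`, every Koszul cycle is homologous to the image of an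
element of the exterior algebra on `k` generators. -/
theorem exists_eq_map_add_contract (hf : WeaklyRegular f) (hg : WeaklyRegular g)
    (hL : functional g ∘ₗ L = functional f) {k : ℕ} (hk : k ≤ r) :
    ∀ z, contract (functional g) z ∈
        initialIdeal f k • (⊤ : Submodule A (ExteriorAlgebra A (Fin s → A))) →
      ∃ c ∈ truncation A r k, ∃ y,
        ∃ x ∈ initialIdeal f k • (⊤ : Submodule A (ExteriorAlgebra A (Fin s → A))),
          z = ExteriorAlgebra.map L c + contract (functional g) y + x := by
  induction k with
  | zero =>
    intro z hz
    rw [initialIdeal_zero, Submodule.bot_smul, Submodule.mem_bot] at hz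
    obtain ⟨c, y, rfl⟩ := exists_eq_add_contract g hg hz
    exact ⟨algebraMap A _ c, algebraMap_mem_truncation 0 c, y, 0, zero_mem _, by simp⟩
  | succ k ih =>
    intro z hz
    let k' : Fin r := ⟨k, hk⟩
    obtain ⟨u, v, hv, hzuv⟩ := mem_initialIdeal_succ_smul_top f k' hz
    -- Here `u` represents the image of `z` under the connecting map: `∂∂z = 0` shows that `f_k ∂u`
    -- vanishes modulo the preceding elements, and `f_k` can be cancelled.
    have hu : contract (functional g) u ∈
        initialIdeal f k • (⊤ : Submodule A (ExteriorAlgebra A (Fin s → A))) := by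
      refine mem_smul_top_of_smul_mem (hf k') ?_
      have h := contract_contract (functional g) z
      rw [hzuv, map_add, map_smul] at h
      rw [eq_neg_of_add_eq_zero_left h]
      exact neg_mem (map_mem_smul_top _ hv)
    obtain ⟨c, hc, y, x, hx, rfl⟩ := ih (by omega) u hu
    set e := ExteriorAlgebra.ι A (dg (A := A) k') with he
    -- The correction makes `z` a cycle modulo one element fewer: `L(e c)` contributes `f_k L(c)`
    -- and `f_k y` contributes `f_k ∂y`, which together cancel `f_k u` up to `f_k x` and a term from
    -- `∂L(c)`.
    have hcz : contract (functional g)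
        (z - ExteriorAlgebra.map L (e * c) - f k' • y) ∈
        initialIdeal f k • (⊤ : Submodule A (ExteriorAlgebra A (Fin s → A))) := by
      have h1 : contract (functional g) (ExteriorAlgebra.map L (e * c)) =
          f k' • ExteriorAlgebra.map L c - ExteriorAlgebra.map L e *
            contract (functional g) (ExteriorAlgebra.map L c) := by
        rw [contract_map, contract_map, hL, contract_ι_mul, functional_dg, map_sub, map_smul,
          map_mul]
      have h2 : contract (functional g) (z - ExteriorAlgebra.map L (e * c) - f k' • y) =
          f k' • x + v + ExteriorAlgebra.map L e *
            contract (functional g) (ExteriorAlgebra.map L c) := by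
        rw [map_sub, map_sub, h1, hzuv, map_smul, smul_add, smul_add]
        abel
      rw [h2]
      exact add_mem (add_mem (Submodule.smul_mem _ _ hx) hv)
        (mul_mem_smul_top _ (contract_map_mem f g L hL (by omega) hc))
    obtain ⟨c', hc', y', x', hx', h⟩ := ih (by omega) _ hcz
    have hle := truncation_mono (A := A) (n := r) (Nat.le_succ k)
    refine ⟨c' + e * c, add_mem (hle hc')
      (ι_dg_mul_mem_truncation (Nat.lt_succ_self k) (hle hc)), y', f k' • y + x',
      smul_add_mem_initialIdeal_succ f k' y hx', ?_⟩
    rw [sub_sub, sub_eq_iff_eq_add] at h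
    rw [h, map_add]
    abel

/-- Modulo the first `k` elements of `f`, an element of the exterior algebra on `k` generators
whose image is a boundary has its coefficients in the ideal `(g)`. -/
theorem mem_smul_top_of_map_eq (hf : WeaklyRegular f)
    (hL : functional g ∘ₗ L = functional f) {k : ℕ} (hk : k ≤ r) :
    ∀ c ∈ truncation A r k, ∀ y,
      ∀ x ∈ initialIdeal f k • (⊤ : Submodule A (ExteriorAlgebra A (Fin s → A))),
        ExteriorAlgebra.map L c = contract (functional g) y + x →
        c ∈ Ideal.span (Set.range g) • (⊤ : Submodule A (ExteriorAlgebra A (Fin r → A))) := by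
  induction k with
  | zero =>
    intro c hc y x hx h
    obtain ⟨c, rfl⟩ := exists_algebraMap_eq_of_mem_truncation_zero hc
    rw [initialIdeal_zero, Submodule.bot_smul, Submodule.mem_bot] at hx
    rw [hx, add_zero, AlgHom.commutes] at h
    have hmem : c ∈ Ideal.span (Set.range g) := mem_of_algebraMap_mem_smul_top (n := s) <| by
      rw [h, ← initialIdeal_self]
      exact contract_mem_initialIdeal g le_rfl y (mem_truncation_self y)
    rw [Algebra.algebraMap_eq_smul_one]
    exact Submodule.smul_mem_smul hmem trivial
  | succ k ih =>
    intro c hc y x hx h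
    let k' : Fin r := ⟨k, hk⟩
    obtain ⟨c₀, hc₀, c₁, hc₁, rfl⟩ := exists_eq_add_ι_mul k' hc
    obtain ⟨u, v, hv, rfl⟩ := mem_initialIdeal_succ_smul_top f k' hx
    set w := L (dg k') with hw
    have hgw : functional g w = f k' := by
      rw [hw, ← LinearMap.comp_apply, hL, functional_dg]
    rw [map_add, map_mul, ExteriorAlgebra.map_apply_ι, ← hw] at h
    -- Differentiating `h` kills `∂y`; cancelling `f_k` then shows that `L(c₁)` is a boundary modulo
    -- the preceding elements.
    have ht : ExteriorAlgebra.map L c₁ - contract (functional g) u ∈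
        initialIdeal f k • (⊤ : Submodule A (ExteriorAlgebra A (Fin s → A))) := by
      refine mem_smul_top_of_smul_mem (hf k') ?_
      have hd := congrArg (contract (functional g)) h
      rw [map_add, contract_ι_mul, hgw, map_add, contract_contract, zero_add, map_add,
        map_smul] at hd
      have : f k' • (ExteriorAlgebra.map L c₁ - contract (functional g) u) =
          contract (functional g) v - contract (functional g) (ExteriorAlgebra.map L c₀) +
            ExteriorAlgebra.ι A w * contract (functional g) (ExteriorAlgebra.map L c₁) := by
        rw [smul_sub, sub_eq_iff_eq_add.1 (eq_sub_of_add_eq' hd)]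
        abel
      rw [this]
      exact add_mem (sub_mem (map_mem_smul_top _ hv) (contract_map_mem f g L hL (by omega) hc₀))
        (mul_mem_smul_top _ (contract_map_mem f g L hL (by omega) hc₁))
    set t := ExteriorAlgebra.map L c₁ - contract (functional g) u with ht'
    have h₁ := ih (by omega) c₁ hc₁ u t ht (by rw [ht']; abel)
    -- Since `∂(w u) = f_k u - w ∂u`, adding `w u` to `y` absorbs both `f_k u` and the boundary part
    -- of `w L(c₁)`.
    have h₀ := ih (by omega) c₀ hc₀ (y + ExteriorAlgebra.ι A w * u)
      (v - ExteriorAlgebra.ι A w * t) (sub_mem hv (mul_mem_smul_top _ ht)) (by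
        rw [eq_sub_of_add_eq h, map_add, contract_ι_mul, hgw, ht', mul_sub]
        abel)
    exact add_mem h₀ (mul_mem_smul_top _ h₁)

end Comparison

/-! ### Passage to a single exterior degree -/

section Grading

variable {A : Type*} [CommRing A] {M N : Type*} [AddCommGroup M] [Module A M]
  [AddCommGroup N] [Module A N]

/-- The projection of the exterior algebra onto its component of degree `ℓ`. -/
noncomputable def proj (ℓ : ℕ) : ExteriorAlgebra A M →ₗ[A] ⋀[A]^ℓ M :=
  DirectSum.component A ℕ (fun i : ℕ => ⋀[A]^i M) ℓ ∘ₗ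
    (DirectSum.decomposeLinearEquiv (fun i : ℕ => ⋀[A]^i M)).toLinearMap

theorem proj_coe {ℓ : ℕ} (x : ⋀[A]^ℓ M) : proj ℓ (x : ExteriorAlgebra A M) = x :=
  Subtype.ext (DirectSum.decompose_of_mem_same (fun i : ℕ => ⋀[A]^i M) x.2)

theorem proj_coe_of_ne {i ℓ : ℕ} (h : i ≠ ℓ) (x : ⋀[A]^i M) :
    proj ℓ (x : ExteriorAlgebra A M) = 0 :=
  Subtype.ext (DirectSum.decompose_of_mem_ne (fun i : ℕ => ⋀[A]^i M) x.2 h)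

theorem coe_exteriorPower_map (L : M →ₗ[A] N) {ℓ : ℕ} (x : ⋀[A]^ℓ M) :
    (exteriorPower.map ℓ L x : ExteriorAlgebra A N) = ExteriorAlgebra.map L x := by
  have h : (⋀[A]^ℓ N).subtype ∘ₗ exteriorPower.map ℓ L =
      (ExteriorAlgebra.map L).toLinearMap ∘ₗ (⋀[A]^ℓ M).subtype := by
    apply exteriorPower.linearMap_ext
    ext m
    simp [exteriorPower.map_apply_ιMulti, exteriorPower.ιMulti_apply_coe,
      ExteriorAlgebra.map_apply_ιMulti]
  exact LinearMap.congr_fun h x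

theorem proj_map (L : M →ₗ[A] N) (ℓ : ℕ) (x : ExteriorAlgebra A M) :
    proj ℓ (ExteriorAlgebra.map L x) = exteriorPower.map ℓ L (proj ℓ x) := by
  induction x using DirectSum.Decomposition.inductionOn fun i : ℕ => ⋀[A]^i M with
  | zero => simp
  | add x y hx hy => simp [hx, hy]
  | @homogeneous i m =>
    rw [← coe_exteriorPower_map]
    rcases eq_or_ne i ℓ with rfl | h
    · rw [proj_coe, proj_coe]
    · rw [proj_coe_of_ne h, proj_coe_of_ne h, map_zero]

theorem coe_d {n : ℕ} (g : Fin n → A) {ℓ : ℕ} (x : ⋀[A]^(ℓ + 1) (Fin n → A)) :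
    (d g ℓ x : ExteriorAlgebra A (Fin n → A)) = contract (functional g) x := rfl

theorem contract_coe_zero (φ : Module.Dual A M) (x : ⋀[A]^0 M) :
    contract φ (x : ExteriorAlgebra A M) = 0 := by
  obtain ⟨x, hx⟩ := x
  rw [ExteriorAlgebra.exteriorPower, pow_zero] at hx
  obtain ⟨c, rfl⟩ := Submodule.mem_one.1 hx
  exact contract_algebraMap φ c

theorem proj_contract {n : ℕ} (g : Fin n → A) (ℓ : ℕ) (x : ExteriorAlgebra A (Fin n → A)) :
    proj ℓ (contract (functional g) x) = d g ℓ (proj (ℓ + 1) x) := by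
  induction x using DirectSum.Decomposition.inductionOn fun i : ℕ => ⋀[A]^i (Fin n → A) with
  | zero => simp
  | add x y hx hy => simp [hx, hy]
  | @homogeneous i m =>
    cases i with
    | zero => rw [contract_coe_zero, proj_coe_of_ne (Nat.succ_ne_zero ℓ).symm, map_zero, map_zero]
    | succ i =>
      rw [← coe_d]
      rcases eq_or_ne i ℓ with rfl | h
      · rw [proj_coe, proj_coe]
      · rw [proj_coe_of_ne h, proj_coe_of_ne (by omega), map_zero]

/-- Each graded piece is a direct summand: inclusion and projection are linear and preserve `I • ⊤`.
-/
theorem coe_mem_smul_top_iff {I : Ideal A} {ℓ : ℕ} (x : ⋀[A]^ℓ M) :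
    (x : ExteriorAlgebra A M) ∈ I • (⊤ : Submodule A (ExteriorAlgebra A M)) ↔
      x ∈ I • (⊤ : Submodule A (⋀[A]^ℓ M)) :=
  ⟨fun h => proj_coe x ▸ map_mem_smul_top (proj ℓ) h,
    fun h => map_mem_smul_top (⋀[A]^ℓ M).subtype h⟩

end Grading

/-! ### Reduction modulo an ideal, and minors as coordinates -/

section Quotient

variable {A : Type*} [CommRing A] {n : ℕ}

/-- The class `1 ⊗ x` of an element `x` of the Koszul complex. -/
noncomputable def oneTmul (B : Type*) [CommRing B] [Algebra A B] (ℓ : ℕ) :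
    ⋀[A]^ℓ (Fin n → A) →+ K A n B ℓ :=
  (ofTensor A n B ℓ).toLinearMap.toAddMonoidHom.comp
    (TensorProduct.mk A B (⋀[A]^ℓ (Fin n → A)) 1).toAddMonoidHom

theorem oneTmul_apply (B : Type*) [CommRing B] [Algebra A B] {ℓ : ℕ} (x : ⋀[A]^ℓ (Fin n → A)) :
    oneTmul B ℓ x = ofTensor A n B ℓ (1 ⊗ₜ[A] x) := rfl

theorem oneTmul_smul (B : Type*) [CommRing B] [Algebra A B] {ℓ : ℕ} (c : A)
    (x : ⋀[A]^ℓ (Fin n → A)) : oneTmul B ℓ (c • x) = algebraMap A B c • oneTmul B ℓ x := by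
  rw [oneTmul_apply, oneTmul_apply, ← map_smul, TensorProduct.tmul_smul, algebraMap_smul]

theorem dB_oneTmul (g : Fin n → A) (B : Type*) [CommRing B] [Algebra A B] {ℓ : ℕ}
    (x : ⋀[A]^(ℓ + 1) (Fin n → A)) : dB g B ℓ (oneTmul B (ℓ + 1) x) = oneTmul B ℓ (d g ℓ x) :=
  rfl

theorem oneTmul_eq_zero_iff (I : Ideal A) {ℓ : ℕ} (x : ⋀[A]^ℓ (Fin n → A)) :
    oneTmul (A ⧸ I) ℓ x = 0 ↔ x ∈ I • (⊤ : Submodule A (⋀[A]^ℓ (Fin n → A))) := by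
  rw [oneTmul_apply, LinearEquiv.map_eq_zero_iff,
    ← (TensorProduct.quotTensorEquivQuotSMul (⋀[A]^ℓ (Fin n → A)) I).map_eq_zero_iff,
    TensorProduct.quotTensorEquivQuotSMul_mk_one_tmul, Submodule.Quotient.mk_eq_zero]

theorem oneTmul_surjective (I : Ideal A) (ℓ : ℕ) :
    Function.Surjective (oneTmul (A := A) (n := n) (A ⧸ I) ℓ) := by
  intro z
  let e := TensorProduct.quotTensorEquivQuotSMul (⋀[A]^ℓ (Fin n → A)) I
  obtain ⟨x, hx⟩ := Submodule.Quotient.mk_surjective _ (e ((ofTensor A n (A ⧸ I) ℓ).symm z))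
  refine ⟨x, ?_⟩
  rw [oneTmul_apply, ← LinearEquiv.eq_symm_apply]
  apply e.injective
  rw [← hx, TensorProduct.quotTensorEquivQuotSMul_mk_one_tmul]

theorem oneTmul_mem_cycles_iff (g : Fin n → A) (I : Ideal A) {ℓ : ℕ} (x : ⋀[A]^ℓ (Fin n → A)) :
    oneTmul (A ⧸ I) ℓ x ∈ cycles g (A ⧸ I) ℓ ↔ contract (functional g) x ∈
      I • (⊤ : Submodule A (ExteriorAlgebra A (Fin n → A))) := by
  cases ℓ with
  | zero => simp [cycles, contract_coe_zero]
  | succ ℓ =>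
    rw [← coe_d, coe_mem_smul_top_iff, ← oneTmul_eq_zero_iff, ← dB_oneTmul]
    exact LinearMap.mem_ker

theorem oneTmul_mem_boundaries_iff (g : Fin n → A) (I : Ideal A) {ℓ : ℕ}
    (x : ⋀[A]^ℓ (Fin n → A)) :
    oneTmul (A ⧸ I) ℓ x ∈ boundaries g (A ⧸ I) ℓ ↔
      ∃ y, x - d g ℓ y ∈ I • (⊤ : Submodule A (⋀[A]^ℓ (Fin n → A))) := by
  rw [boundaries, LinearMap.mem_range, (oneTmul_surjective (n := n) I (ℓ + 1)).exists]
  refine exists_congr fun y => ?_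
  rw [← oneTmul_eq_zero_iff, map_sub, sub_eq_zero, dB_oneTmul, eq_comm]

/-- The coordinates of a wedge of rows are its pairings with the dual basis, and each such pairing
is a determinant. -/
theorem ιMulti_eq_sum_det {r ℓ : ℕ} (a : Matrix (Fin r) (Fin n) A) (j : Fin ℓ → Fin r) :
    exteriorPower.ιMulti A ℓ (fun p => a (j p)) =
      ∑ i : Fin ℓ ↪o Fin n, (a.submatrix j i).det •
        exteriorPower.ιMulti A ℓ (fun p => dg (A := A) (i p)) := by
  rw [← ((Pi.basisFun A (Fin n)).exteriorPower ℓ).sum_repr (exteriorPower.ιMulti A ℓ _),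
    ← Set.powersetCard.ofFinEmbEquiv.sum_comp]
  refine Finset.sum_congr rfl fun i _ => ?_
  rw [exteriorPower.basis_repr_apply, exteriorPower.ιMultiDual_apply_ιMulti,
    exteriorPower.basis_apply, exteriorPower.ιMulti_family, Equiv.symm_apply_apply]
  congr 2
  ext p
  simp

theorem minorElement_eq_oneTmul {r : ℕ} (a : Matrix (Fin r) (Fin n) A)
    (B : Type*) [CommRing B] [Algebra A B] (ℓ : ℕ) (j : Fin ℓ ↪o Fin r) :
    minorElement a B ℓ j = oneTmul B ℓ (exteriorPower.map ℓ (Fintype.linearCombination A a)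
      (exteriorPower.ιMulti A ℓ fun p => dg (j p))) := by
  have h : ⇑(Fintype.linearCombination A a) ∘ (fun p => dg (A := A) (j p)) =
      fun p => a (j p) := by
    funext p
    exact (Fintype.linearCombination_apply_single A a (j p) 1).trans (one_smul A _)
  rw [exteriorPower.map_apply_ιMulti, h, ιMulti_eq_sum_det, map_sum, minorElement]
  refine Finset.sum_congr rfl fun i _ => ?_
  rw [oneTmul_smul, oneTmul_apply, ← map_smul, TensorProduct.smul_tmul', smul_eq_mul, mul_one]

/-- The standard basis of an exterior power of `A^n`, indexed by increasing sequences. -/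
noncomputable def dgBasis (A : Type*) [CommRing A] (n ℓ : ℕ) :
    Module.Basis (Fin ℓ ↪o Fin n) A (⋀[A]^ℓ (Fin n → A)) :=
  ((Pi.basisFun A (Fin n)).exteriorPower ℓ).reindex Set.powersetCard.ofFinEmbEquiv.symm

theorem dgBasis_apply (ℓ : ℕ) (j : Fin ℓ ↪o Fin n) :
    dgBasis A n ℓ j = exteriorPower.ιMulti A ℓ fun p => dg (j p) := by
  rw [dgBasis, Module.Basis.reindex_apply, exteriorPower.basis_apply, exteriorPower.ιMulti_family,
    Equiv.symm_symm, Equiv.symm_apply_apply]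
  congr 1
  ext p
  simp

end Quotient

/-! ### Cycles and boundaries over `A/(f)`, and the basis theorem -/

section Main

variable {A : Type*} [CommRing A] {r s : ℕ} {f : Fin r → A} {g : Fin s → A}

theorem exists_sub_map_mem_boundaries (hf : WeaklyRegular f) (hg : WeaklyRegular g)
    {L : (Fin r → A) →ₗ[A] Fin s → A} (hL : functional g ∘ₗ L = functional f) {ℓ : ℕ}
    (x : ⋀[A]^ℓ (Fin s → A))
    (hx : oneTmul (A ⧸ Ideal.span (Set.range f)) ℓ x ∈ cycles g (A ⧸ Ideal.span (Set.range f)) ℓ) :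
    ∃ c, oneTmul (A ⧸ Ideal.span (Set.range f)) ℓ (x - exteriorPower.map ℓ L c) ∈
      boundaries g (A ⧸ Ideal.span (Set.range f)) ℓ := by
  rw [oneTmul_mem_cycles_iff, ← initialIdeal_self] at hx
  obtain ⟨c, -, y, v, hv, h⟩ := exists_eq_map_add_contract f g L hf hg hL le_rfl _ hx
  refine ⟨proj ℓ c, (oneTmul_mem_boundaries_iff _ _ _).2 ⟨proj (ℓ + 1) y, ?_⟩⟩
  rw [← proj_map, ← proj_contract, ← proj_coe x, h, ← map_sub, ← map_sub]
  refine map_mem_smul_top _ ?_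
  rw [← initialIdeal_self]
  convert hv using 1
  abel

theorem map_mem_cycles {L : (Fin r → A) →ₗ[A] Fin s → A}
    (hL : functional g ∘ₗ L = functional f) {ℓ : ℕ} (c : ⋀[A]^ℓ (Fin r → A)) :
    oneTmul (A ⧸ Ideal.span (Set.range f)) ℓ (exteriorPower.map ℓ L c) ∈
      cycles g (A ⧸ Ideal.span (Set.range f)) ℓ := by
  rw [oneTmul_mem_cycles_iff, coe_exteriorPower_map, ← initialIdeal_self]
  exact contract_map_mem f g L hL le_rfl (mem_truncation_self _)

theorem mem_smul_top_of_map_mem_boundaries (hf : WeaklyRegular f)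
    {L : (Fin r → A) →ₗ[A] Fin s → A} (hL : functional g ∘ₗ L = functional f) {ℓ : ℕ}
    (c : ⋀[A]^ℓ (Fin r → A))
    (hc : oneTmul (A ⧸ Ideal.span (Set.range f)) ℓ (exteriorPower.map ℓ L c) ∈
      boundaries g (A ⧸ Ideal.span (Set.range f)) ℓ) :
    c ∈ Ideal.span (Set.range g) • (⊤ : Submodule A (⋀[A]^ℓ (Fin r → A))) := by
  obtain ⟨y, hy⟩ := (oneTmul_mem_boundaries_iff _ _ _).1 hc
  rw [← coe_mem_smul_top_iff] at hy ⊢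
  rw [← initialIdeal_self] at hy
  refine mem_smul_top_of_map_eq f g L hf hL le_rfl _ (mem_truncation_self _) y _ hy ?_
  rw [← coe_exteriorPower_map, ← coe_d, ← Submodule.coe_add, add_sub_cancel]

theorem sum_smul_homologyClass {R : Type*} [CommRing R] [Algebra A R] {ι : Type*} [Fintype ι]
    {ℓ : ℕ} (c : ι → A) (z : ι → cycles g R ℓ) :
    ∑ j, Ideal.Quotient.mk (extIdeal g R) (algebraMap A R (c j)) • homologyClass g R ℓ (z j) =
      homologyClass g R ℓ (∑ j, algebraMap A R (c j) • z j) := by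
  rw [map_sum]
  refine Finset.sum_congr rfl fun j _ => ?_
  rw [map_smul]
  exact (isTorsionBySet_homology g R ℓ).mk_smul _ _

end Main

end Koszul

theorem mainTheorem3 {Q : Type*} [CommRing Q] [IsNoetherianRing Q] [IsLocalRing Q]
    {r s : ℕ} (f : Fin r → Q) (g : Fin s → Q)
    (hf : RingTheory.Sequence.IsRegular Q (List.ofFn f))
    (hg : RingTheory.Sequence.IsRegular Q (List.ofFn g))
    (a : Matrix (Fin r) (Fin s) Q) (ha : ∀ j, f j = ∑ i, a j i * g i) (ℓ : ℕ) :
    let R := Q ⧸ Ideal.span (Set.range f)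
    let J : Ideal R := Koszul.extIdeal g R
    ∃ hz : ∀ j : Fin ℓ ↪o Fin r, Koszul.minorElement a R ℓ j ∈ Koszul.cycles g R ℓ,
    ∃ b : Module.Basis (Fin ℓ ↪o Fin r) (R ⧸ J) (Koszul.Homology g R ℓ),
      ∀ j, b j = Koszul.homologyClass g R ℓ ⟨Koszul.minorElement a R ℓ j, hz j⟩ := by
  intro R J
  have hf' := Koszul.weaklyRegular_of_isWeaklyRegular f hf.toIsWeaklyRegular
  have hg' := Koszul.weaklyRegular_of_isWeaklyRegular g hg.toIsWeaklyRegular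
  let L : (Fin r → Q) →ₗ[Q] Fin s → Q := Fintype.linearCombination Q a
  have hL : Koszul.functional g ∘ₗ L = Koszul.functional f := by
    ext j
    have hj : L (Koszul.dg j) = a j :=
      (Fintype.linearCombination_apply_single Q a j 1).trans (one_smul Q _)
    change Koszul.functional g (L (Koszul.dg j)) = Koszul.functional f (Koszul.dg j)
    rw [hj, Koszul.functional_dg, ha, Koszul.functional, Fintype.linearCombination_apply]
    rfl
  have hminor (j : Fin ℓ ↪o Fin r) : Koszul.minorElement a R ℓ j =
      Koszul.oneTmul R ℓ (exteriorPower.map ℓ L (Koszul.dgBasis Q r ℓ j)) := by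
    rw [Koszul.dgBasis_apply]
    exact Koszul.minorElement_eq_oneTmul a R ℓ j
  have hz (j : Fin ℓ ↪o Fin r) : Koszul.minorElement a R ℓ j ∈ Koszul.cycles g R ℓ := by
    rw [hminor]
    exact Koszul.map_mem_cycles hL _
  let z (j : Fin ℓ ↪o Fin r) : Koszul.cycles g R ℓ := ⟨Koszul.minorElement a R ℓ j, hz j⟩
  have hsum (c : (Fin ℓ ↪o Fin r) → Q) :
      ((∑ j, algebraMap Q R (c j) • z j : Koszul.cycles g R ℓ) : Koszul.K Q s R ℓ) =
        Koszul.oneTmul R ℓ (exteriorPower.map ℓ L (∑ j, c j • Koszul.dgBasis Q r ℓ j)) := by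
    simp only [map_sum, map_smul, Koszul.oneTmul_smul, Submodule.coe_sum, Submodule.coe_smul, z,
      hminor]
  have hlift : Function.Surjective fun c : Q => Ideal.Quotient.mk J (algebraMap Q R c) :=
    Ideal.Quotient.mk_surjective.comp Ideal.Quotient.mk_surjective
  have hli : LinearIndependent (R ⧸ J) fun j => Koszul.homologyClass g R ℓ (z j) := by
    refine Fintype.linearIndependent_iff.2 fun c hc j => ?_
    choose c' hc' using fun j => hlift (c j)
    obtain rfl : (fun j => Ideal.Quotient.mk J (algebraMap Q R (c' j))) = c := funext hc'
    rw [Koszul.sum_smul_homologyClass, Koszul.homologyClass_eq_zero_iff, hsum] at hc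
    -- A lifted relation has all its coefficients in `(g)`, so they vanish in `R/J`.
    have hmem := (Koszul.mem_smul_top_iff_repr (Koszul.dgBasis Q r ℓ) _ _).1
      (Koszul.mem_smul_top_of_map_mem_boundaries hf' hL _ hc) j
    rw [Module.Basis.repr_sum_self] at hmem
    exact Ideal.Quotient.eq_zero_iff_mem.2 (Ideal.mem_map_of_mem _ hmem)
  have hspan : ⊤ ≤ Submodule.span (R ⧸ J)
      (Set.range fun j => Koszul.homologyClass g R ℓ (z j)) := by
    rintro h -
    obtain ⟨⟨y, hy⟩, rfl⟩ : ∃ y, Koszul.homologyClass g R ℓ y = h :=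
      Submodule.mkQ_surjective _ h
    obtain ⟨x, rfl⟩ := Koszul.oneTmul_surjective _ ℓ y
    obtain ⟨c, hc⟩ := Koszul.exists_sub_map_mem_boundaries hf' hg' hL x hy
    -- The coefficients are the coordinates of the preimage `c` in the standard basis of the
    -- exterior power of `Q^r`.
    have hxc : Koszul.homologyClass g R ℓ ⟨Koszul.oneTmul R ℓ x, hy⟩ =
        Koszul.homologyClass g R ℓ
          (∑ j, algebraMap Q R ((Koszul.dgBasis Q r ℓ).repr c j) • z j) := by
      rw [← sub_eq_zero, ← map_sub, Koszul.homologyClass_eq_zero_iff, Submodule.coe_sub, hsum,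
        Module.Basis.sum_repr, ← map_sub]
      exact hc
    rw [hxc, ← Koszul.sum_smul_homologyClass]
    exact Submodule.sum_mem _ fun j _ =>
      Submodule.smul_mem _ _ (Submodule.subset_span ⟨j, rfl⟩)
  exact ⟨hz, Module.Basis.mk hli hspan, fun j => Module.Basis.mk_apply hli hspan j⟩
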